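/- Let $G$ be a locally compact, $\sigma$-compact abelian group (written additively) acting continuously, via $G\times X\to X$, $(t,y)\mapsto ty$, on a compact metric space $X$. For $x\in X$ and $f\in C(X)$ (continuous complex-valued functions on $X$) put $f_x\colon G\to\mathbb{C}$, $f_x(t)=f(tx)$, and let $\mathcal{A}_x=\{f_x : f\in C(X)\}$; this is contained in the Banach space $C_u(G)$ of bounded uniformly continuous functions $G\to\mathbb{C}$ with the supremum norm. A function $g\in C_u(G)$ is called *weakly almost periodic* if $\{g(\cdot-t): t\in G\}$ is relatively compact in the weak topology of the Banach space $C_u(G)$. A bounded continuous $g\colon G\to\mathbb{C}$ is called *Bohr almost periodic* if for every $\varepsilon>0$ the set $A=\{t\in G : \|g-g(\cdot-t)\|_\infty<\varepsilon\}$ is relatively dense, i.e. $G=\bigcup_{a\in A}(a+K)$ for some compact $K\subset G$. A point $x\in X$ is called weakly (respectively Bohr) almost periodic if every function in $\mathcal{A}_x$ is weakly (respectively Bohr) almost periodic. **Proposition.** Let $x\in X$ be weakly almost periodic. Then $x$ is Bohr almost periodic if and only if its orbit closure $\overline{Gx}$ is minimal, i.e. every $y\in\overline{Gx}$ has orbit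 dense in $\overline{Gx}$. -/

import Mathlib

open scoped BoundedContinuousFunction

namespace AlmostPeriodic

/-! ### Functions on an abelian topological group

`G` carries the (unique) uniform structure compatible with its topology as a commutative
topological group: `IsUniformAddGroup G`. -/

section Functions

variable {G : Type*} [AddCommGroup G] [UniformSpace G] [IsUniformAddGroup G]

/-- `A ⊆ G` is relatively dense: `G = ⋃_{a ∈ A} (a + K)` for some compact `K ⊆ G`. -/
def RelativelyDense (A : Set G) : Prop :=
  ∃ K : Set G, IsCompact K ∧ (⋃ a ∈ A, (fun k : G => a + k) '' K) = Set.univ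

/-- The translate `f(· - t)` of a bounded continuous function `f` on `G`. -/
noncomputable def bcfTranslate (t : G) (f : G →ᵇ ℂ) : G →ᵇ ℂ :=
  f.compContinuous ⟨fun s : G => s - t, continuous_id.sub continuous_const⟩

/-- Bohr almost periodicity of a bounded continuous function `f`: for every `ε > 0` the set of
`t` with `‖f - f(· - t)‖_∞ < ε` is relatively dense. -/
def IsBohrAP (f : G →ᵇ ℂ) : Prop :=
  ∀ ε : ℝ, 0 < ε → RelativelyDense {t : G | ‖f - bcfTranslate t f‖ < ε}

variable (G) in
/-- The Banach space `C_u(G)` of bounded uniformly continuous complex functions on `G`, with the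
supremum norm inherited from `G →ᵇ ℂ`. -/
noncomputable def Cu : Submodule ℂ (G →ᵇ ℂ) where
  carrier := {f | UniformContinuous f}
  zero_mem' := uniformContinuous_const
  add_mem' := fun hf hg => UniformContinuous.add hf hg
  smul_mem' := fun c _ hf => UniformContinuous.const_smul hf c

theorem bcfTranslate_mem_Cu (t : G) {f : G →ᵇ ℂ} (hf : f ∈ Cu G) : bcfTranslate t f ∈ Cu G :=
  UniformContinuous.comp (g := f) hf (uniformContinuous_id.sub uniformContinuous_const)

/-- Weak almost periodicity of `f ∈ C_u(G)`: the set of translates `{f(· - t) : t ∈ G}` is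
relatively compact in the weak topology of the Banach space `C_u(G)`. -/
def IsWeaklyAP (f : Cu G) : Prop :=
  IsCompact (closure (Set.range fun t : G =>
    toWeakSpace ℂ (Cu G) ⟨bcfTranslate t (f : G →ᵇ ℂ), bcfTranslate_mem_Cu t f.2⟩))

end Functions

/-! ### Points of a dynamical system `(X, G)` -/

section Points

variable (G : Type*) {X : Type*} [AddCommGroup G] [UniformSpace G] [IsUniformAddGroup G]
  [MetricSpace X] [CompactSpace X] [AddAction G X] [ContinuousVAdd G X]

/-- The function `f_x : G → ℂ`, `f_x(t) = f(t x)`. -/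
noncomputable def orbitFunction (x : X) (f : C(X, ℂ)) : G →ᵇ ℂ :=
  (BoundedContinuousFunction.mkOfCompact f).compContinuous
    ⟨fun t : G => t +ᵥ x, continuous_id.vadd continuous_const⟩

theorem orbitFunction_mem_Cu (x : X) (f : C(X, ℂ)) : orbitFunction G x f ∈ Cu G := by
  have hf : UniformContinuous f := CompactSpace.uniformContinuous_of_continuous f.continuous
  refine UniformContinuous.comp (g := f) hf ?_
  show UniformContinuous (fun t : G => t +ᵥ x)
  refine Metric.uniformity_basis_dist.tendsto_right_iff.2 ?_
  intro ε hε
  have h0 : ∀ y ∈ (Set.univ : Set X), ∀ᶠ p : X × G in nhds y ×ˢ nhds (0 : G),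
      dist (p.2 +ᵥ p.1) p.1 < ε := by
    intro y _
    rw [← nhds_prod_eq]
    have hc : Continuous fun p : X × G => dist (p.2 +ᵥ p.1) p.1 :=
      (continuous_snd.vadd continuous_fst).dist continuous_fst
    exact hc.continuousAt.eventually_lt continuousAt_const (by simpa using hε)
  have h1 : ∀ᶠ u : G in nhds (0 : G), ∀ y ∈ (Set.univ : Set X), dist (u +ᵥ y) y < ε := by
    have := isCompact_univ.eventually_forall_of_forall_eventually
      (x₀ := (0 : G)) (P := fun (u : G) (y : X) => dist (u +ᵥ y) y < ε)
      (fun y hy => by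
        rw [nhds_prod_eq, Filter.prod_comm]
        exact h0 y hy)
    exact this
  rw [uniformity_eq_comap_nhds_zero G]
  filter_upwards [Filter.preimage_mem_comap h1] with p hp
  have := hp (p.1 +ᵥ x) (Set.mem_univ _)
  rw [vadd_vadd, sub_add_cancel] at this
  rw [dist_comm] at this
  exact this

/-- The set `𝒜_x = {f_x : f ∈ C(X)}`, as a subset of `C_u(G)`. -/
def orbitAlgebra (x : X) : Set (Cu G) :=
  Set.range fun f : C(X, ℂ) => (⟨orbitFunction G x f, orbitFunction_mem_Cu G x f⟩ : Cu G)

/-- `x` is weakly almost periodic: `𝒜_x` consists of weakly almost periodic functions. -/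
def IsWeaklyAPPoint (x : X) : Prop :=
  ∀ g ∈ orbitAlgebra G x, IsWeaklyAP g

/-- `x` is Bohr almost periodic: `𝒜_x` consists of Bohr almost periodic functions. -/
def IsBohrAPPoint (x : X) : Prop :=
  ∀ g ∈ orbitAlgebra G x, IsBohrAP (g : G →ᵇ ℂ)

/-- The orbit closure of `x`, with the restricted action of `G`. -/
def orbitClosure (x : X) : SubAddAction G X where
  carrier := closure (AddAction.orbit G x)
  vadd_mem' := fun t y hy => by
    refine map_mem_closure (continuous_const_vadd t) hy ?_
    intro z hz
    exact AddAction.mem_orbit_of_mem_orbit t hz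

end Points

end AlmostPeriodic

namespace AlmostPeriodic

open Filter Set Topology TopologicalSpace

/-! Minimal implies Bohr: by weak almost periodicity every `f_y`, with `y` in the orbit closure, is
a weak limit of translates of `f_x`. Those translates form a norm separable set because `G` is
σ-compact, and passing to the weak closure keeps separability. So `y ↦ f_y` has separable range, and
Baire yields a nonempty open `U` on which it oscillates little in norm. By minimality finitely many
translates of `U` cover the orbit closure; translations do not increase norm distances, so return
times to `U` supply a relatively dense set of almost periods. Conversely, Bohr almost periodicity of
`t ↦ dist (t +ᵥ x) x` puts `x` in the closure of every orbit inside its orbit closure. -/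

/-- The weak closure of a separable subset of a normed space is norm separable. -/
theorem isSeparable_preimage_closure_toWeakSpace {E : Type*} [NormedAddCommGroup E]
    [NormedSpace ℂ E] {S : Set E} (hS : IsSeparable S) :
    IsSeparable (toWeakSpace ℂ E ⁻¹' closure (toWeakSpace ℂ E '' S)) := by
  refine (hS.span (R := ℂ)).closure.mono fun v hv => ?_
  have hconv : Convex ℝ (Submodule.span ℂ S : Set E) :=
    ((Submodule.span ℂ S).restrictScalars ℝ).convex
  have h := closure_mono (image_mono (f := toWeakSpace ℂ E)
    (Submodule.subset_span (R := ℂ) (s := S))) hv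
  -- Mazur: norm and weak closures of the convex set `span ℂ S` agree.
  rw [← hconv.toWeakSpace_closure ℂ] at h
  obtain ⟨w, hw, hwv⟩ := h
  exact (toWeakSpace ℂ E).injective hwv ▸ hw

section Points

variable (G : Type*) {X : Type*} [AddCommGroup G] [UniformSpace G] [IsUniformAddGroup G]
  [MetricSpace X] [CompactSpace X] [AddAction G X] [ContinuousVAdd G X]

/-- The function `f_x` as an element of `C_u(G)`. -/
noncomputable def orbitCu (f : C(X, ℂ)) (x : X) : Cu G :=
  ⟨orbitFunction G x f, orbitFunction_mem_Cu G x f⟩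

variable {G}

omit [IsUniformAddGroup G] in
theorem orbitFunction_apply (x : X) (f : C(X, ℂ)) (t : G) :
    orbitFunction G x f t = f (t +ᵥ x) := rfl

theorem bcfTranslate_orbitFunction (t : G) (f : C(X, ℂ)) (x : X) :
    bcfTranslate t (orbitFunction G x f) = orbitFunction G (-t +ᵥ x) f := by
  ext s
  change f ((s - t) +ᵥ x) = f (s +ᵥ (-t +ᵥ x))
  rw [vadd_vadd, sub_eq_add_neg]

theorem norm_orbitCu_sub_le_iff (f : C(X, ℂ)) (y : X) (h : Cu G) {ε : ℝ} (hε : 0 ≤ ε) :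
    ‖orbitCu G f y - h‖ ≤ ε ↔ ∀ t : G, ‖f (t +ᵥ y) - (h : G →ᵇ ℂ) t‖ ≤ ε :=
  BoundedContinuousFunction.norm_le (f := orbitFunction G y f - (h : G →ᵇ ℂ)) hε

theorem norm_orbitCu_vadd_sub (f : C(X, ℂ)) (t : G) (y z : X) :
    ‖orbitCu G f (t +ᵥ y) - orbitCu G f (t +ᵥ z)‖ ≤ ‖orbitCu G f y - orbitCu G f z‖ := by
  rw [norm_orbitCu_sub_le_iff f _ _ (norm_nonneg _)]
  intro s
  have := (norm_orbitCu_sub_le_iff f y (orbitCu G f z) (norm_nonneg _)).1 le_rfl (s + t)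
  simpa only [orbitCu, orbitFunction_apply, vadd_vadd] using this

/-- Uniform continuity of `f_x` gives norm continuity along the orbit, although `y ↦ f_y` need not
be norm continuous on `X`. -/
theorem continuous_orbitCu_vadd (f : C(X, ℂ)) (x : X) :
    Continuous fun t : G => orbitCu G f (t +ᵥ x) := by
  rw [continuous_iff_continuousAt]
  intro t₀
  rw [Metric.continuousAt_iff']
  intro ε hε
  have hu : UniformContinuous (orbitFunction G x f) := orbitFunction_mem_Cu G x f
  have h := hu (Metric.dist_mem_uniformity (half_pos hε))
  rw [mem_map, uniformity_eq_comap_nhds_zero G, mem_comap] at h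
  obtain ⟨V, hV, hVs⟩ := h
  have hc : Tendsto (fun t : G => t₀ - t) (𝓝 t₀) (𝓝 0) := by
    simpa only [sub_self] using (continuous_sub_left t₀).tendsto t₀
  filter_upwards [hc hV] with t ht
  rw [dist_eq_norm]
  refine lt_of_le_of_lt ((norm_orbitCu_sub_le_iff f _ _ (half_pos hε).le).2 fun s => ?_)
    (half_lt_self hε)
  have hm : (s + t, s + t₀) ∈ (fun p : G × G => p.2 - p.1) ⁻¹' V := by
    simpa using ht
  have := hVs hm
  simp only [mem_preimage, mem_ofPred_eq, dist_eq_norm, orbitFunction_apply] at this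
  simpa only [orbitCu, orbitFunction_apply, vadd_vadd] using this.le

theorem isSeparable_range_orbitCu_vadd [SigmaCompactSpace G] (f : C(X, ℂ)) (x : X) :
    IsSeparable (range fun t : G => orbitCu G f (t +ᵥ x)) := by
  rw [← image_univ, ← iUnion_compactCovering G, image_iUnion, isSeparable_iUnion]
  exact fun n => ((isCompact_compactCovering G n).image (continuous_orbitCu_vadd f x)).isSeparable

theorem range_toWeakSpace_bcfTranslate_orbitCu (f : C(X, ℂ)) (x : X) :
    (range fun t : G => toWeakSpace ℂ (Cu G)
      ⟨bcfTranslate t (orbitCu G f x : G →ᵇ ℂ), bcfTranslate_mem_Cu t (orbitCu G f x).2⟩) =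
    toWeakSpace ℂ (Cu G) '' range fun t : G => orbitCu G f (t +ᵥ x) := by
  rw [← range_comp, ← (Equiv.neg G).surjective.range_comp]
  congr 1
  funext t
  refine congrArg (toWeakSpace ℂ (Cu G)) (Subtype.ext ?_)
  change bcfTranslate (-t) (orbitFunction G x f) = orbitFunction G (t +ᵥ x) f
  rw [bcfTranslate_orbitFunction, neg_neg]

omit [AddCommGroup G] [IsUniformAddGroup G] in
theorem continuous_eval_weakSpace (s : G) :
    Continuous fun w : WeakSpace ℂ (Cu G) =>
      (((toWeakSpace ℂ (Cu G)).symm w : Cu G) : G →ᵇ ℂ) s :=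
  WeakBilin.eval_continuous (topDualPairing ℂ (Cu G)).flip
    ((BoundedContinuousFunction.evalCLM ℂ s).comp (Cu G).subtypeL)

/-- If `f_x` is weakly almost periodic, then the weak closure of its translates contains `f_y`
for every `y` in the orbit closure of `x`. -/
theorem toWeakSpace_orbitCu_mem_closure {f : C(X, ℂ)} {x y : X}
    (hf : IsWeaklyAP (orbitCu G f x)) (hy : y ∈ closure (AddAction.orbit G x)) :
    toWeakSpace ℂ (Cu G) (orbitCu G f y) ∈
      closure (toWeakSpace ℂ (Cu G) '' range fun t : G => orbitCu G f (t +ᵥ x)) := by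
  rw [IsWeaklyAP, range_toWeakSpace_bcfTranslate_orbitCu] at hf
  have hne : (comap (fun t : G => t +ᵥ x) (𝓝 y)).NeBot :=
    comap_neBot_iff.2 fun U hU => by
      obtain ⟨_, hzU, t, rfl⟩ := mem_closure_iff_nhds.1 hy U hU
      exact ⟨t, hzU⟩
  obtain ⟨u, hu⟩ := Ultrafilter.exists_le (comap (fun t : G => t +ᵥ x) (𝓝 y))
  have hux : Tendsto (fun t : G => t +ᵥ x) u (𝓝 y) := tendsto_iff_comap.2 hu
  obtain ⟨w, hw, hlim⟩ := hf.ultrafilter_le_nhds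
    (u.map fun t : G => toWeakSpace ℂ (Cu G) (orbitCu G f (t +ᵥ x)))
    (le_principal_iff.2 (Ultrafilter.mem_map.2
      (univ_mem' fun t => subset_closure ⟨_, ⟨t, rfl⟩, rfl⟩)))
  have hlim' : Tendsto (fun t : G => toWeakSpace ℂ (Cu G) (orbitCu G f (t +ᵥ x))) u (𝓝 w) := hlim
  suffices toWeakSpace ℂ (Cu G) (orbitCu G f y) = w by rwa [this]
  -- Point evaluations are weakly continuous, so the weak limit `w` is determined by its pointwise
  -- values.
  refine (LinearEquiv.eq_symm_apply _).1 (Subtype.ext (BoundedContinuousFunction.ext fun s => ?_))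
  refine tendsto_nhds_unique (l := (u : Filter G)) (f := fun t : G => f (s +ᵥ (t +ᵥ x))) ?_ ?_
  · exact ((f.continuous.comp (continuous_const_vadd s)).tendsto y).comp hux
  · exact ((continuous_eval_weakSpace s).tendsto w).comp hlim'

theorem isSeparable_orbitCu_image_closure_orbit [SigmaCompactSpace G] {f : C(X, ℂ)} {x : X}
    (hf : IsWeaklyAP (orbitCu G f x)) :
    IsSeparable (orbitCu G f '' closure (AddAction.orbit G x)) :=
  (isSeparable_preimage_closure_toWeakSpace (isSeparable_range_orbitCu_vadd f x)).mono <|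
    image_subset_iff.2 fun _ hy => toWeakSpace_orbitCu_mem_closure hf hy

/-- The sup norm bound is an intersection of pointwise conditions, each closed in `y`; this is what
Baire needs. -/
theorem isClosed_setOf_norm_orbitCu_sub_le (f : C(X, ℂ)) (h : Cu G) {ε : ℝ} (hε : 0 ≤ ε) :
    IsClosed {y : X | ‖orbitCu G f y - h‖ ≤ ε} := by
  simp only [norm_orbitCu_sub_le_iff f _ h hε, ofPred_forall]
  exact isClosed_iInter fun t => isClosed_le
    ((f.continuous.comp (continuous_const_vadd t)).sub continuous_const).norm continuous_const

instance (x : X) : CompactSpace (orbitClosure G x) :=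
  isCompact_iff_compactSpace.1 (isClosed_closure (s := AddAction.orbit G x)).isCompact

instance (x : X) : ContinuousConstVAdd G (orbitClosure G x) :=
  ⟨fun t => ((continuous_const_vadd t).comp continuous_subtype_val).subtype_mk _⟩

/-- If `y ↦ f_y` has separable range on the orbit closure, then by Baire category its oscillation
is at most `ε` on some nonempty open set. -/
theorem exists_isOpen_norm_orbitCu_sub_le {f : C(X, ℂ)} {x : X}
    (hsep : IsSeparable (orbitCu G f '' closure (AddAction.orbit G x))) {ε : ℝ} (hε : 0 < ε) :
    ∃ U : Set (orbitClosure G x), IsOpen U ∧ U.Nonempty ∧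
      ∀ y ∈ U, ∀ z ∈ U, ‖orbitCu G f y - orbitCu G f z‖ ≤ ε := by
  have hxm : x ∈ closure (AddAction.orbit G x) := subset_closure (AddAction.mem_orbit_self x)
  have : Nonempty (orbitClosure G x) := ⟨⟨x, hxm⟩⟩
  obtain ⟨c, hc, hcs⟩ := hsep
  have := hc.to_subtype
  obtain ⟨h, hU⟩ := nonempty_interior_of_iUnion_of_closed
    (f := fun h : c => {y : orbitClosure G x | ‖orbitCu G f y - h‖ ≤ ε / 2})
    (fun h => (isClosed_setOf_norm_orbitCu_sub_le f (h : Cu G) (half_pos hε).le).preimage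
      continuous_subtype_val)
    (iUnion_eq_univ_iff.2 fun y => by
      obtain ⟨h, hh, hd⟩ := Metric.mem_closure_iff.1 (hcs ⟨y, y.2, rfl⟩) _ (half_pos hε)
      exact ⟨⟨h, hh⟩, (dist_eq_norm (orbitCu G f y) h).symm.trans_le hd.le⟩)
  refine ⟨_, isOpen_interior, hU, fun y hy z hz => ?_⟩
  have hy' : ‖orbitCu G f y - h‖ ≤ ε / 2 :=
    (interior_subset hy : y ∈ {w : orbitClosure G x | ‖orbitCu G f w - h‖ ≤ ε / 2})
  have hz' : ‖orbitCu G f z - h‖ ≤ ε / 2 :=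
    (interior_subset hz : z ∈ {w : orbitClosure G x | ‖orbitCu G f w - h‖ ≤ ε / 2})
  rw [norm_sub_rev] at hz'
  linarith [norm_sub_le_norm_sub_add_norm_sub (orbitCu G f y) (h : Cu G) (orbitCu G f z)]

omit [IsUniformAddGroup G] in
theorem relativelyDense_of_finite_translates {A : Set G} (F : Finset G)
    (hF : ∀ t, ∃ k ∈ F, t - k ∈ A) : RelativelyDense A := by
  refine ⟨F, F.finite_toSet.isCompact, eq_univ_of_forall fun t => ?_⟩
  obtain ⟨k, hk, hA⟩ := hF t
  exact mem_iUnion₂.2 ⟨t - k, hA, k, hk, sub_add_cancel t k⟩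

theorem isBohrAPPoint_of_isMinimal [SigmaCompactSpace G] {x : X} (hx : IsWeaklyAPPoint G x)
    [AddAction.IsMinimal G (orbitClosure G x)] : IsBohrAPPoint G x := by
  rintro _ ⟨f, rfl⟩ ε hε
  obtain ⟨U, hUo, hUne, hU⟩ := exists_isOpen_norm_orbitCu_sub_le
    (isSeparable_orbitCu_image_closure_orbit (hx _ ⟨f, rfl⟩)) (half_pos hε)
  let x₀ : orbitClosure G x := ⟨x, subset_closure (AddAction.mem_orbit_self x)⟩
  obtain ⟨g, hg⟩ := hUo.exists_vadd_mem G x₀ hUne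
  obtain ⟨I, hI⟩ := isCompact_univ.exists_finite_cover_vadd G hUo hUne
  classical
  -- If `-t +ᵥ x = k +ᵥ y` with `y ∈ U`, then `s = t + k + g` satisfies `-s +ᵥ x = -g +ᵥ y`, while
  -- `x = -g +ᵥ (g +ᵥ x)` with `g +ᵥ x ∈ U`; hence `s` is an almost period.
  refine relativelyDense_of_finite_translates (I.image fun k => -k - g) fun t => ?_
  obtain ⟨k, hk, y, hy, hyt⟩ := mem_iUnion₂.1 (hI (mem_univ (-t +ᵥ x₀)))
  refine ⟨-k - g, Finset.mem_image_of_mem _ hk, ?_⟩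
  have hyt' : k +ᵥ (y : X) = -t +ᵥ x := congrArg Subtype.val hyt
  have hy' : -(t - (-k - g)) +ᵥ x = -g +ᵥ (y : X) := by
    rw [← neg_vadd_vadd k (y : X), hyt', vadd_vadd, vadd_vadd]
    congr 1
    abel
  change ‖orbitFunction G x f - bcfTranslate _ (orbitFunction G x f)‖ < ε
  rw [bcfTranslate_orbitFunction, hy']
  have h := (norm_orbitCu_vadd_sub f (-g) ((g +ᵥ x₀ : orbitClosure G x) : X) y).trans
    (hU _ hg _ hy)
  have hgx : -g +ᵥ ((g +ᵥ x₀ : orbitClosure G x) : X) = x := neg_vadd_vadd g x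
  rw [hgx] at h
  exact lt_of_le_of_lt h (half_lt_self hε)

/-- On the orbit, write `s = a + k` with `a` an almost period of `dist (· +ᵥ x) x`; then `-k` moves
`s +ᵥ x` to `a +ᵥ x`, near `x`. Since `k` ranges over a compact set, this passes to limits. -/
theorem exists_dist_vadd_le_of_isBohrAPPoint {x : X} (hx : IsBohrAPPoint G x) {ε : ℝ}
    (hε : 0 < ε) {y : X} (hy : y ∈ closure (AddAction.orbit G x)) :
    ∃ k : G, dist (k +ᵥ y) x ≤ ε := by
  let f : C(X, ℂ) := ⟨fun z => (dist z x : ℂ), by fun_prop⟩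
  obtain ⟨K, hK, hKA⟩ := hx _ ⟨f, rfl⟩ ε hε
  let C : Set (G × X) := {p | dist (-p.1 +ᵥ p.2) x ≤ ε}
  have hC : IsClosed C := isClosed_le
    ((continuous_fst.neg.vadd continuous_snd).dist continuous_const) continuous_const
  have := isCompact_iff_compactSpace.1 hK
  have hP : IsClosed (Prod.snd '' {p : K × X | ((p.1 : G), p.2) ∈ C}) :=
    isClosedMap_snd_of_compactSpace _
      (hC.preimage ((continuous_subtype_val.comp continuous_fst).prodMk continuous_snd))
  obtain ⟨⟨k, z⟩, hkz, rfl⟩ : y ∈ Prod.snd '' {p : K × X | ((p.1 : G), p.2) ∈ C} := by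
    refine closure_minimal ?_ hP hy
    rintro _ ⟨s, rfl⟩
    obtain ⟨a, ha, k, hk, hak⟩ := mem_iUnion₂.1 (hKA.symm ▸ mem_univ s)
    refine ⟨⟨⟨k, hk⟩, s +ᵥ x⟩, ?_, rfl⟩
    -- Evaluating at `a` makes the translated term `dist (0 +ᵥ x) x = 0`.
    have h1 := (BoundedContinuousFunction.norm_coe_le_norm _ a).trans ha.le
    change ‖(dist (a +ᵥ x) x : ℂ) - (dist ((a - a) +ᵥ x) x : ℂ)‖ ≤ ε at h1
    change dist (-k +ᵥ s +ᵥ x) x ≤ ε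
    have h2 : -k +ᵥ s +ᵥ x = a +ᵥ x := by
      rw [vadd_vadd, ← hak]; congr 1; simp
    rw [h2]
    simpa using h1
  exact ⟨-k, hkz⟩

theorem isMinimal_of_isBohrAPPoint {x : X} (hx : IsBohrAPPoint G x) :
    AddAction.IsMinimal G (orbitClosure G x) := by
  refine ⟨fun y z => ?_⟩
  rw [closure_subtype]
  have himg : ((↑) '' AddAction.orbit G y : Set X) = AddAction.orbit G (y : X) := by
    rw [AddAction.orbit, ← range_comp]; rfl
  rw [himg]
  have hxy : x ∈ closure (AddAction.orbit G (y : X)) := Metric.mem_closure_iff.2 fun ε hε => by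
    obtain ⟨k, hk⟩ := exists_dist_vadd_le_of_isBohrAPPoint hx (half_pos hε) y.2
    exact ⟨_, ⟨k, rfl⟩, by rw [dist_comm]; exact hk.trans_lt (half_lt_self hε)⟩
  refine closure_minimal ?_ isClosed_closure z.2
  rintro _ ⟨t, rfl⟩
  exact (orbitClosure G (y : X)).vadd_mem t hxy

end Points

end AlmostPeriodic

theorem mainTheorem12 {G X : Type*}
    [AddCommGroup G] [UniformSpace G] [IsUniformAddGroup G]
    [LocallyCompactSpace G] [SigmaCompactSpace G]
    [MetricSpace X] [CompactSpace X] [AddAction G X] [ContinuousVAdd G X]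
    (x : X) (hx : AlmostPeriodic.IsWeaklyAPPoint G x) :
    AlmostPeriodic.IsBohrAPPoint G x ↔
      AddAction.IsMinimal G (AlmostPeriodic.orbitClosure G x) :=
  ⟨AlmostPeriodic.isMinimal_of_isBohrAPPoint,
    fun _ => AlmostPeriodic.isBohrAPPoint_of_isMinimal hx⟩
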